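/- Let $G$ be a countable group. A \emph{system} is a measure-preserving action of $G$ on a standard Borel probability space (atoms are allowed, ergodicity is not required). A \emph{factor} of a system is the restriction of the action to an invariant sub-$\sigma$-algebra; equivalently it is given, up to isomorphism, by a measure-preserving, almost everywhere equivariant map onto another system. Systems, factors and $\sigma$-algebras are considered up to null sets, and a property of systems is understood to be invariant under isomorphism. A factor is \emph{nontrivial} if its $\sigma$-algebra contains a set whose measure is neither $0$ nor $1$. A property of systems is \emph{hereditarily stable} if (i) every factor of a system with the property has the property, and (ii) every system whose $\sigma$-algebra is generated, up to null sets, by a family of factors having the property has the property itself. Two systems $S$ on $(X,\mu)$ and $T$ on $(Y,\nu)$ are \emph{disjoint} if $\mu\times\nu$ is their only joining, i.e. the only measure on $X\times Y$ that is invariant under the diagonal action of $G$ and has marginals $\mu$ and $\nu$. \textbf{Theorem.} Let $S$ be a system that has some hereditarily stable property, and let $T$ be a system such that neither $T$ nor any nontrivial factor of $T$ has this property. Then $S$ and $T$ are disjoint. -/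

import Mathlib

open MeasureTheory
open scoped MeasureTheory

universe u v

/-- A measure-preserving action of the group `G` on a standard probability space:
a standard Borel space with a probability measure (atoms allowed, ergodicity not required),
on which every group element acts by a measurable measure-preserving transformation. -/
structure MPSystem (G : Type u) [Group G] where
  X : Type v
  [measurableSpace : MeasurableSpace X]
  [standardBorel : StandardBorelSpace X]
  μ : Measure X
  [isProbability : IsProbabilityMeasure μ]
  [action : MulAction G X]
  measurePreserving : ∀ g : G, MeasurePreserving (fun x : X => g • x) μ μ

namespace MPSystem

attribute [instance] MPSystem.measurableSpace MPSystem.standardBorel MPSystem.isProbability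
  MPSystem.action

variable {G : Type u} [Group G]

/-- Up to null sets, every set of the sigma-algebra `𝓐` belongs to the sigma-algebra `𝓑`. -/
def AELe (S : MPSystem.{u, v} G) (𝓐 𝓑 : MeasurableSpace S.X) : Prop :=
  ∀ A : Set S.X, MeasurableSet[𝓐] A → ∃ B : Set S.X, MeasurableSet[𝓑] B ∧ A =ᵐ[S.μ] B

/-- `𝓐` is an invariant sub-sigma-algebra of the action `S` (invariance being understood, as
everything in measure theory, up to null sets). The factors of `S` are the restrictions of the
action to such sigma-algebras. -/
structure IsInvariant (S : MPSystem.{u, v} G) (𝓐 : MeasurableSpace S.X) : Prop where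
  le : 𝓐 ≤ S.measurableSpace
  preimage : ∀ (g : G) (A : Set S.X), MeasurableSet[𝓐] A →
    ∃ B : Set S.X, MeasurableSet[𝓐] B ∧ (fun x : S.X => g • x) ⁻¹' A =ᵐ[S.μ] B

/-- `π` is a factor map from `S` to `F`: it is measure-preserving and almost everywhere
equivariant. -/
structure IsFactorMap (S F : MPSystem.{u, v} G) (π : S.X → F.X) : Prop where
  measurePreserving : MeasurePreserving π S.μ F.μ
  equivariant : ∀ g : G, ∀ᵐ x ∂S.μ, π (g • x) = g • π x

/-- The system `F` is (isomorphic to) the factor of `S` given by the sigma-algebra `𝓐`: there is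
a factor map `π : S → F` such that the sigma-algebra of the `π`-preimages of measurable sets
coincides with `𝓐` up to null sets. -/
def IsFactorOn (F S : MPSystem.{u, v} G) (𝓐 : MeasurableSpace S.X) : Prop :=
  ∃ π : S.X → F.X, S.IsFactorMap F π ∧
    S.AELe 𝓐 (F.measurableSpace.comap π) ∧ S.AELe (F.measurableSpace.comap π) 𝓐

/-- The factor of `S` given by `𝓐` is nontrivial. -/
def IsNontrivialOn (S : MPSystem.{u, v} G) (𝓐 : MeasurableSpace S.X) : Prop :=
  ∃ A : Set S.X, MeasurableSet[𝓐] A ∧ S.μ A ≠ 0 ∧ S.μ A ≠ 1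

/-- A property `P` of systems is inherited by factors. Since the factor is taken up to
isomorphism, this includes invariance of `P` under isomorphism (`𝓐` the whole
sigma-algebra). -/
def InheritedByFactors (P : MPSystem.{u, v} G → Prop) : Prop :=
  ∀ (S F : MPSystem.{u, v} G) (𝓐 : MeasurableSpace S.X),
    S.IsInvariant 𝓐 → F.IsFactorOn S 𝓐 → P S → P F

/-- A property `P` of systems is inherited by every system that is generated (up to null sets) by
some family of factors having the property. -/
def InheritedByGenerated (P : MPSystem.{u, v} G → Prop) : Prop :=
  ∀ (S : MPSystem.{u, v} G) (𝒜 : Set (MeasurableSpace S.X)),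
    (∀ 𝓐 ∈ 𝒜, S.IsInvariant 𝓐 ∧ ∃ F : MPSystem.{u, v} G, F.IsFactorOn S 𝓐 ∧ P F) →
    S.AELe S.measurableSpace (sSup 𝒜) → P S

/-- Hereditarily stable properties of systems. -/
structure HereditarilyStable (P : MPSystem.{u, v} G → Prop) : Prop where
  factors : InheritedByFactors P
  generated : InheritedByGenerated P

/-- A joining of `S` and `T`: a measure on the product, invariant under the diagonal action, whose
marginals are the measures of `S` and `T`. -/
structure IsJoining (S T : MPSystem.{u, v} G) (ν : Measure (S.X × T.X)) : Prop where
  map_fst : ν.map Prod.fst = S.μ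
  map_snd : ν.map Prod.snd = T.μ
  invariant : ∀ g : G, ν.map (fun p : S.X × T.X => (g • p.1, g • p.2)) = ν

/-- Two systems are disjoint if the product measure is their only joining. -/
def Disjoint (S T : MPSystem.{u, v} G) : Prop :=
  ∀ ν : Measure (S.X × T.X), S.IsJoining T ν → ν = S.μ.prod T.μ

end MPSystem

/-! Disintegrate a joining `ν` over `T` as an equivariant family of measures `κ y` on `S.X`; the
joining is the product once every function `y ↦ κ y A` is almost everywhere constant. Mix the
infinite powers of `κ y` over `T.μ`. The result, `powerSystem`, is an infinite self-joining of `S`: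
its coordinates are factors isomorphic to `S` and generate it, so it has the property.

Given `y`, the coordinates are i.i.d. of law `κ y`, so by the law of large numbers the frequency of
visits to `A` recovers `κ y A` (`ae_upperFrequency_eq`). Hence the factor of `T` generated by the
translates of `y ↦ κ y A` is also a factor of the self-joining (`map_orbitMap_upperFrequency`) and
has the property. By hypothesis it is trivial, so `κ y A` is constant. -/

open ProbabilityTheory Filter Topology

/-! ### Infinite powers of kernels and the law of large numbers -/

section IID

variable {X Y : Type*} [MeasurableSpace X] [MeasurableSpace Y]

/-- The infinite power `y ↦ κ y ⊗ κ y ⊗ ⋯` of a Markov kernel is measurable. -/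
lemma measurable_infinitePi_kernel (κ : Kernel Y X) [IsMarkovKernel κ] :
    Measurable fun y => Measure.infinitePi (fun _ : ℕ => κ y) := by
  refine .measure_of_isPiSystem_of_isProbabilityMeasure
    (S := measurableCylinders (fun _ : ℕ => X)) generateFrom_measurableCylinders.symm
    isPiSystem_measurableCylinders ?_
  intro s hs
  obtain ⟨I, A, hA, rfl⟩ := (mem_measurableCylinders s).1 hs
  have h : ∀ y, Measure.infinitePi (fun _ : ℕ => κ y) (cylinder I A)
      = Measure.pi (fun _ : I => κ y) A := fun y => Measure.infinitePi_cylinder _ hA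
  simp_rw [h]
  refine (Measure.measurable_coe hA).comp ?_
  refine .measure_of_isPiSystem_of_isProbabilityMeasure generateFrom_pi.symm isPiSystem_pi ?_
  rintro _ ⟨t, ht, rfl⟩
  simp_rw [Measure.pi_pi]
  exact Finset.measurable_prod _ fun i _ => κ.measurable_coe (ht i (Set.mem_univ i))

/-- The upper asymptotic frequency of visits to `A` along a sequence. -/
noncomputable def upperFrequency (A : Set X) (x : ℕ → X) : ℝ :=
  limsup (fun n : ℕ => (∑ i ∈ Finset.range n, A.indicator (fun _ => (1 : ℝ)) (x i)) / n) atTop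

/-- Taking a limsup rather than a limit gives a function defined, and measurable, on all sequences.
-/
lemma measurable_upperFrequency {A : Set X} (hA : MeasurableSet A) :
    Measurable (upperFrequency A) := by
  refine Measurable.limsup fun n => ?_
  refine Measurable.div_const ?_ _
  exact Finset.measurable_sum _ fun i _ =>
    (measurable_const.indicator hA).comp (measurable_pi_apply i)

/-- The frequency of visits to `A` along an i.i.d. sequence is the probability of `A`. -/
lemma ae_upperFrequency_eq (p : Measure X) [IsProbabilityMeasure p] {A : Set X}
    (hA : MeasurableSet A) :
    ∀ᵐ x ∂Measure.infinitePi (fun _ : ℕ => p), upperFrequency A x = p.real A := by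
  set f : X → ℝ := A.indicator (fun _ => (1 : ℝ)) with hf
  have hfm : Measurable f := measurable_const.indicator hA
  have hev : ∀ i : ℕ, MeasurePreserving (fun x : ℕ → X => x i)
      (Measure.infinitePi (fun _ : ℕ => p)) p := fun i => measurePreserving_eval_infinitePi _ i
  have hfi : Integrable f p := (integrable_const 1).indicator hA
  have hlln := strong_law_ae_real (μ := Measure.infinitePi (fun _ : ℕ => p))
    (fun i x => f (x i)) ((hev 0).integrable_comp_of_integrable hfi)
    (fun i j hij => (iIndepFun_infinitePi (fun _ => hfm)).indepFun hij)
    (fun i => ⟨(hfm.comp (hev i).measurable).aemeasurable, (hfm.comp (hev 0).measurable).aemeasurable, by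
      have h : ∀ i, Measure.map (fun x : ℕ → X => f (x i)) (Measure.infinitePi fun _ : ℕ => p)
          = p.map f := fun i => by
        conv_rhs => rw [← (hev i).map_eq]
        rw [Measure.map_map hfm (hev i).measurable]
        rfl
      rw [h, h]⟩)
  have hint : ∫ x, f (x 0) ∂Measure.infinitePi (fun _ : ℕ => p) = p.real A := by
    have := integral_map (hev 0).measurable.aemeasurable
      (hfm.aestronglyMeasurable
        (μ := (Measure.infinitePi fun _ : ℕ => p).map fun x : ℕ → X => x 0))
    rw [← this, (hev 0).map_eq, hf, integral_indicator_const _ hA]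
    simp
  rw [hint] at hlln
  filter_upwards [hlln] with x hx using hx.limsup_eq

/-- If `a` takes almost surely the value `b y` under `f y`, then `a` has the law of `b` under the
mixture of the `f y`. -/
lemma map_bind_eq_map_of_ae_eq {Z : Type*} [MeasurableSpace Z] {m : Measure Y}
    {f : Y → Measure X} [∀ y, IsProbabilityMeasure (f y)] (hf : Measurable f) {a : X → Z}
    {b : Y → Z} (ha : Measurable a) (hb : Measurable b)
    (hab : ∀ᵐ y ∂m, ∀ᵐ x ∂f y, a x = b y) : (m.bind f).map a = m.map b := by
  ext s hs
  rw [Measure.map_apply ha hs, Measure.map_apply hb hs, Measure.bind_apply (ha hs) hf.aemeasurable,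
    ← lintegral_indicator_one (hb hs)]
  refine lintegral_congr_ae ?_
  filter_upwards [hab] with y hy
  -- Under `f y` the event `a ∈ s` has probability one or zero, according to whether `b y ∈ s`.
  by_cases hys : y ∈ b ⁻¹' s
  · rw [Set.indicator_of_mem hys, Pi.one_apply, ← mem_ae_iff_prob_eq_one (ha hs)]
    filter_upwards [hy] with x hx
    rwa [Set.mem_preimage, hx]
  · rw [Set.indicator_of_notMem hys]
    refine measure_eq_zero_iff_ae_notMem.2 ?_
    filter_upwards [hy] with x hx
    rwa [Set.mem_preimage, hx]

end IID

namespace MPSystem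

variable {G : Type u} [Group G]

/-! ### Factor maps and the factor generated by a function -/

/-- The preimage sigma-algebra under a factor map is invariant. -/
lemma IsFactorMap.isInvariant {S F : MPSystem.{u, v} G} {π : S.X → F.X}
    (h : S.IsFactorMap F π) : S.IsInvariant (F.measurableSpace.comap π) where
  le := h.measurePreserving.measurable.comap_le
  preimage := by
    rintro g _ ⟨B, hB, rfl⟩
    refine ⟨π ⁻¹' ((fun y => g • y) ⁻¹' B), ⟨_, (F.measurePreserving g).measurable hB, rfl⟩, ?_⟩
    filter_upwards [h.equivariant g] with x hx
    exact propext (by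
      change π (g • x) ∈ B ↔ g • π x ∈ B
      rw [hx])

/-- A factor map exhibits its target as the factor on the preimage sigma-algebra. -/
lemma IsFactorMap.isFactorOn {S F : MPSystem.{u, v} G} {π : S.X → F.X}
    (h : S.IsFactorMap F π) : F.IsFactorOn S (F.measurableSpace.comap π) :=
  ⟨π, h, fun A hA => ⟨A, hA, ae_eq_rfl⟩, fun A hA => ⟨A, hA, ae_eq_rfl⟩⟩

/-- The values of `f` along the orbit of a point; `G` is replaced by its copy in the universe
of the phase spaces. -/
noncomputable def orbitMap [Small.{v} G] {X : Type*} [SMul G X] (f : X → ℝ) (x : X) :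
    Shrink.{v} G → ℝ :=
  fun k => f ((equivShrink G).symm k • x)

/-- The shift action of `G` on real functions on (a copy of) `G`. -/
@[reducible] noncomputable def shiftAction (G : Type u) [Group G] [Small.{v} G] :
    MulAction G (Shrink.{v} G → ℝ) where
  -- Multiplying the argument on the right gives a left action, and `k • g • x = (k * g) • x` makes
  -- `orbitMap` equivariant.
  smul h φ := fun k => φ (equivShrink G ((equivShrink G).symm k * h))
  one_smul φ := by
    funext k
    change φ (equivShrink G ((equivShrink G).symm k * 1)) = φ k
    simp
  mul_smul a b φ := by
    funext k
    change φ (equivShrink G ((equivShrink G).symm k * (a * b))) =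
      φ (equivShrink G ((equivShrink G).symm (equivShrink G ((equivShrink G).symm k * a)) * b))
    simp [mul_assoc]

lemma measurable_orbitMap [Small.{v} G] (T : MPSystem.{u, v} G) {f : T.X → ℝ}
    (hf : Measurable f) : Measurable (orbitMap.{u, v} (G := G) f) :=
  measurable_pi_lambda _ fun _ => hf.comp (T.measurePreserving _).measurable

/-- The factor of `T` generated by the translates of a real function `f`. -/
noncomputable def orbitSystem [Countable G] [Small.{v} G] (T : MPSystem.{u, v} G) {f : T.X → ℝ}
    (hf : Measurable f) : MPSystem.{u, v} G where
  X := Shrink.{v} G → ℝ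
  standardBorel :=
    have : Countable (Shrink.{v} G) := (equivShrink G).symm.injective.countable
    inferInstance
  μ := T.μ.map (orbitMap f)
  isProbability := Measure.isProbabilityMeasure_map (T.measurable_orbitMap hf).aemeasurable
  action := shiftAction G
  measurePreserving g := by
    let _ := shiftAction.{u, v} G
    have hm : Measurable (fun φ : Shrink.{v} G → ℝ => g • φ) :=
      measurable_pi_lambda _ fun k => measurable_pi_apply _
    refine ⟨hm, ?_⟩
    have hfm := T.measurable_orbitMap hf
    rw [Measure.map_map hm hfm]
    conv_rhs => rw [← (T.measurePreserving g).map_eq]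
    rw [Measure.map_map hfm (T.measurePreserving g).measurable]
    congr 1
    funext x k
    change f ((equivShrink G).symm (equivShrink G ((equivShrink G).symm k * g)) • x) =
      f ((equivShrink G).symm k • g • x)
    simp [mul_smul]

/-- A function on `S` whose orbit map has the same law as that of `f` gives a factor map. -/
lemma isFactorMap_orbitSystem [Countable G] [Small.{v} G] (S T : MPSystem.{u, v} G)
    {f : T.X → ℝ} (hf : Measurable f) {e : S.X → ℝ} (he : Measurable e)
    (h : S.μ.map (orbitMap e) = T.μ.map (orbitMap.{u, v} (G := G) f)) :
    S.IsFactorMap (T.orbitSystem hf) (orbitMap e) where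
  measurePreserving := ⟨S.measurable_orbitMap he, h⟩
  equivariant g := by
    refine ae_of_all _ fun x => ?_
    funext k
    change e ((equivShrink G).symm k • g • x) =
      e ((equivShrink G).symm (equivShrink G ((equivShrink G).symm k * g)) • x)
    simp [mul_smul]

/-! ### Mixtures of infinite powers of an equivariant kernel -/

/-- A kernel `κ` from `T` to `S` is equivariant if its average is the measure of `S` and it is
almost everywhere equivariant. -/
structure IsEquivariantKernel (T S : MPSystem.{u, v} G) (κ : Kernel T.X S.X) : Prop where
  bind : T.μ.bind κ = S.μ
  equivariant : ∀ g : G, ∀ᵐ y ∂T.μ, (κ y).map (fun x => g • x) = κ (g • y)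

/-- The mixture of the infinite powers of an equivariant kernel: an infinite self-joining of
`S`. -/
noncomputable def powerSystem {T S : MPSystem.{u, v} G} (κ : Kernel T.X S.X) [IsMarkovKernel κ]
    (h : T.IsEquivariantKernel S κ) : MPSystem.{u, v} G where
  X := ℕ → S.X
  μ := T.μ.bind fun y => Measure.infinitePi (fun _ : ℕ => κ y)
  isProbability := isProbabilityMeasure_bind (measurable_infinitePi_kernel κ).aemeasurable
    (ae_of_all _ fun _ => inferInstance)
  measurePreserving g := by
    have hg : Measurable (fun x : S.X => g • x) := (S.measurePreserving g).measurable
    have hm : Measurable (fun x : ℕ → S.X => g • x) :=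
      measurable_pi_lambda _ fun i => hg.comp (measurable_pi_apply i)
    have hκ := measurable_infinitePi_kernel κ
    refine ⟨hm, ?_⟩
    ext s hs
    rw [Measure.map_apply hm hs, Measure.bind_apply (hm hs) hκ.aemeasurable,
      Measure.bind_apply hs hκ.aemeasurable]
    -- For almost every `y`, `g` carries the power of `κ y` to that of `κ (g • y)`; invariance of
    -- `T.μ` then removes the shift in `y`.
    refine Eq.trans (lintegral_congr_ae ?_)
      ((T.measurePreserving g).lintegral_comp ((Measure.measurable_coe hs).comp hκ))
    filter_upwards [h.equivariant g] with y hy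
    have := Measure.infinitePi_map_pi (fun _ : ℕ => κ y) (fun _ : ℕ => hg)
    rw [← Measure.map_apply hm hs]
    simp only [← hy]
    exact congrArg (fun m => m s) this

section powerSystem

variable {T S : MPSystem.{u, v} G} (κ : Kernel T.X S.X) [IsMarkovKernel κ]
  (h : T.IsEquivariantKernel S κ)

lemma isFactorMap_eval_powerSystem (i : ℕ) :
    (powerSystem κ h).IsFactorMap S (fun x : ℕ → S.X => x i) where
  measurePreserving := by
    refine ⟨measurable_pi_apply i, ?_⟩
    have hκ := measurable_infinitePi_kernel κ
    have hi : Measurable (fun x : ℕ → S.X => x i) := measurable_pi_apply i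
    change (T.μ.bind fun y => Measure.infinitePi (fun _ : ℕ => κ y)).map _ = _
    rw [← h.bind]
    ext s hs
    rw [Measure.map_apply hi hs, Measure.bind_apply (hi hs) hκ.aemeasurable,
      Measure.bind_apply hs κ.measurable.aemeasurable]
    refine lintegral_congr fun y => ?_
    rw [← Measure.map_apply hi hs, Measure.infinitePi_map_eval]
  equivariant _ := ae_of_all _ fun _ => rfl

/-- A property inherited by generated systems passes to the mixture of infinite powers. -/
lemma InheritedByGenerated.powerSystem {P : MPSystem.{u, v} G → Prop}
    (hP : InheritedByGenerated P) (hS : P S) : P (powerSystem κ h) := by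
  refine hP _ (Set.range fun i : ℕ => S.measurableSpace.comap (fun x : ℕ → S.X => x i)) ?_ ?_
  · rintro _ ⟨i, rfl⟩
    have hi := isFactorMap_eval_powerSystem κ h i
    exact ⟨hi.isInvariant, S, hi.isFactorOn, hS⟩
  · intro A hA
    refine ⟨A, ?_, ae_eq_rfl⟩
    rw [sSup_range]
    exact hA

/-- The function `y ↦ κ y A` and the frequency of visits to `A` have orbit maps of the same law. -/
lemma map_orbitMap_upperFrequency [Countable G] [Small.{v} G] {A : Set S.X}
    (hA : MeasurableSet A) :
    (powerSystem κ h).μ.map (orbitMap.{u, v} (G := G) (X := (powerSystem κ h).X)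
      (upperFrequency A)) = T.μ.map (orbitMap.{u, v} (G := G) fun y => (κ y).real A) := by
  have hκ := measurable_infinitePi_kernel κ
  have hfm : Measurable fun y => (κ y).real A := (κ.measurable_coe hA).ennreal_toReal
  have h1 := (powerSystem κ h).measurable_orbitMap
    (f := upperFrequency A) (measurable_upperFrequency hA)
  have h2 := T.measurable_orbitMap hfm
  have key : ∀ᵐ y ∂T.μ, ∀ᵐ x ∂Measure.infinitePi (fun _ : ℕ => κ y),
      orbitMap.{u, v} (G := G) (X := (powerSystem κ h).X) (upperFrequency A) x
        = orbitMap.{u, v} (G := G) (fun y => (κ y).real A) y := by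
    have : Countable (Shrink.{v} G) := (equivShrink G).symm.injective.countable
    -- Since `G` is countable, one null set of `y` serves all group elements.
    filter_upwards [ae_all_iff.2 h.equivariant] with y hy
    -- The translated coordinates are i.i.d. of law `κ (k • y)`, so the law of large numbers applies
    -- to each translate.
    have hall : ∀ k : Shrink.{v} G, ∀ᵐ x ∂Measure.infinitePi (fun _ : ℕ => κ y),
        upperFrequency A (fun i => (equivShrink G).symm k • x i)
          = (κ ((equivShrink G).symm k • y)).real A := by
      intro k
      have hg : Measurable (fun x : S.X => (equivShrink G).symm k • x) :=
        (S.measurePreserving _).measurable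
      have hpi := Measure.infinitePi_map_pi (fun _ : ℕ => κ y) (fun _ : ℕ => hg)
      simp only [hy] at hpi
      have := ae_upperFrequency_eq (κ ((equivShrink G).symm k • y)) hA
      rw [← hpi] at this
      exact ae_of_ae_map (measurable_pi_lambda _ fun i =>
        hg.comp (measurable_pi_apply i)).aemeasurable this
    filter_upwards [ae_all_iff.2 hall] with x hx
    funext k
    exact hx k
  exact map_bind_eq_map_of_ae_eq (m := T.μ) hκ h1 h2 key

end powerSystem

/-! ### Joinings as equivariant kernels, and the conclusion -/

/-- The disintegration of a joining over its second marginal is an equivariant kernel. -/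
lemma IsJoining.isEquivariantKernel {S T : MPSystem.{u, v} G} {ν : Measure (S.X × T.X)}
    (hν : S.IsJoining T ν) {κ : Kernel T.X S.X} [IsMarkovKernel κ]
    (hκ : T.μ ⊗ₘ κ = ν.map Prod.swap) : T.IsEquivariantKernel S κ where
  bind := by
    rw [← Measure.snd_compProd, hκ, Measure.snd,
      Measure.map_map measurable_snd measurable_swap, ← hν.map_fst]
    rfl
  equivariant g := by
    have hgS : ∀ g : G, Measurable (fun x : S.X => g • x) :=
      fun g => (S.measurePreserving g).measurable
    have hgT : ∀ g : G, Measurable (fun x : T.X => g • x) :=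
      fun g => (T.measurePreserving g).measurable
    set η : Kernel T.X S.X := κ.map (fun x => g • x)
    set θ : Kernel T.X S.X := κ.comap (fun y => g • y) (hgT g)
    have : IsMarkovKernel η := Kernel.IsMarkovKernel.map κ (hgS g)
    have hprod : ∀ (B : Set T.X) (A : Set S.X), MeasurableSet B → MeasurableSet A →
        ∫⁻ y in B, κ y A ∂T.μ = ν (A ×ˢ B) := by
      intro B A hB hA
      rw [← Measure.compProd_apply_prod hB hA, hκ,
        Measure.map_apply measurable_swap (hB.prod hA), Set.preimage_swap_prod]
    have hinv : ∀ (B : Set T.X) (A : Set S.X), MeasurableSet B → MeasurableSet A →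
        ν (((fun x => g • x) ⁻¹' A) ×ˢ ((fun y => g • y) ⁻¹' B)) = ν (A ×ˢ B) := by
      intro B A hB hA
      conv_rhs => rw [← hν.invariant g]
      exact (Measure.map_apply (((hgS g).comp measurable_fst).prodMk
        ((hgT g).comp measurable_snd)) (hA.prod hB)).symm
    -- On `B ×ˢ A` the two sides are `ν (g⁻¹A × B)` and `ν (A × gB)`, equal by invariance of `ν`.
    -- Uniqueness of disintegrations then gives `η = θ` almost everywhere.
    have heq : T.μ ⊗ₘ η = T.μ ⊗ₘ θ := by
      refine Measure.ext_prod fun {B A} hB hA => ?_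
      have hB' : B = (fun y => g • y) ⁻¹' ((fun y => g⁻¹ • y) ⁻¹' B) := by
        ext y; simp
      rw [Measure.compProd_apply_prod hB hA, Measure.compProd_apply_prod hB hA]
      simp only [η, θ, Kernel.map_apply' _ (hgS g) _ hA, Kernel.comap_apply]
      rw [hprod _ _ hB (hgS g hA)]
      conv_rhs => rw [hB']
      rw [(T.measurePreserving g).setLIntegral_comp_preimage (hgT g⁻¹ hB)
        (κ.measurable_coe hA), hprod _ _ (hgT g⁻¹ hB) hA, ← hinv _ _ (hgT g⁻¹ hB) hA, ← hB']
    filter_upwards [Kernel.ae_eq_of_compProd_eq heq] with y hy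
    rw [Kernel.map_apply _ (hgS g), Kernel.comap_apply] at hy
    exact hy

/-- A real function measurable with respect to a trivial factor is constant. -/
lemma ae_eq_const_of_not_isNontrivialOn (T : MPSystem.{u, v} G) {𝓐 : MeasurableSpace T.X}
    (hle : 𝓐 ≤ T.measurableSpace) (h𝓐 : ¬ T.IsNontrivialOn 𝓐) {f : T.X → ℝ}
    (hf : Measurable[𝓐] f) : ∃ c, f =ᵐ[T.μ] Function.const _ c := by
  -- Countably many measurable sets separate the points of `ℝ`, so it suffices that each preimage is
  -- null or conull.
  refine exists_eventuallyEq_const_of_forall_separating MeasurableSet fun U hU => ?_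
  by_contra hcon
  rw [not_or] at hcon
  refine h𝓐 ⟨f ⁻¹' U, hf hU, fun h0 => hcon.2 (measure_eq_zero_iff_ae_notMem.1 h0), fun h1 => ?_⟩
  exact hcon.1 ((prob_compl_eq_zero_iff (hle _ (hf hU))).2 h1)

end MPSystem

theorem mainTheorem4 {G : Type u} [Group G] [Countable G]
    (P : MPSystem.{u, v} G → Prop) (hP : MPSystem.HereditarilyStable P)
    (S T : MPSystem.{u, v} G) (hS : P S) (hT : ¬ P T)
    (hTF : ∀ (𝓐 : MeasurableSpace T.X) (F : MPSystem.{u, v} G),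
      T.IsInvariant 𝓐 → T.IsNontrivialOn 𝓐 → F.IsFactorOn T 𝓐 → ¬ P F) :
    S.Disjoint T := by
  intro ν hν
  have : Nonempty S.X := nonempty_of_isProbabilityMeasure S.μ
  -- The orbit system lives on functions on `G`, which must lie in the universe of the phase spaces.
  have : Small.{v} G := Countable.toSmall G
  have hprob : IsProbabilityMeasure ν := by
    have : IsProbabilityMeasure (ν.map Prod.fst) := hν.map_fst ▸ S.isProbability
    exact Measure.isProbabilityMeasure_of_map Prod.fst
  have hswap : IsProbabilityMeasure (ν.map Prod.swap) :=
    Measure.isProbabilityMeasure_map measurable_swap.aemeasurable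
  -- `condKernel` conditions on the first coordinate, hence the swap.
  set κ := (ν.map Prod.swap).condKernel
  have hκ : T.μ ⊗ₘ κ = ν.map Prod.swap := by
    have hfst : (ν.map Prod.swap).fst = T.μ := by
      rw [Measure.fst, Measure.map_map measurable_fst measurable_swap, ← hν.map_snd]
      rfl
    rw [← hfst]
    exact (ν.map Prod.swap).disintegrate κ
  have hequi := hν.isEquivariantKernel hκ
  refine Measure.ext_prod fun {A B} hA hB => ?_
  have hfm : Measurable fun y => (κ y).real A := (κ.measurable_coe hA).ennreal_toReal
  -- One and the same system is a factor of `T`, through `κ y A`, and of the self-joining, through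
  -- visit frequencies.
  have hTmap := T.isFactorMap_orbitSystem T hfm hfm rfl
  have hWmap := (MPSystem.powerSystem κ hequi).isFactorMap_orbitSystem T hfm
    (measurable_upperFrequency hA) (MPSystem.map_orbitMap_upperFrequency κ hequi hA)
  have hPF : P (T.orbitSystem hfm) := hP.factors _ _ _ hWmap.isInvariant hWmap.isFactorOn
    (hP.generated.powerSystem κ hequi hS)
  obtain ⟨c, hc⟩ := T.ae_eq_const_of_not_isNontrivialOn hTmap.isInvariant.le
    (fun hn => hTF _ _ hTmap.isInvariant hn hTmap.isFactorOn hPF)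
    (f := fun y => (κ y).real A) (by
      -- The function is the coordinate at the identity of its own orbit map.
      have h1 : Measurable fun φ : Shrink.{v} G → ℝ => φ (equivShrink G 1) := measurable_pi_apply _
      convert! h1.comp (comap_measurable
        (MPSystem.orbitMap.{u, v} (G := G) fun y => (κ y).real A)) using 1
      funext y
      simp [MPSystem.orbitMap])
  have hc' : ∀ᵐ y ∂T.μ, κ y A = ENNReal.ofReal c := by
    filter_upwards [hc] with y hy
    rw [← ENNReal.ofReal_toReal (measure_ne_top (κ y) A)]
    exact congrArg _ hy
  -- Averaging `κ y A` over `y` identifies the constant.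
  have hSA : S.μ A = ENNReal.ofReal c := by
    rw [← hequi.bind, Measure.bind_apply hA κ.measurable.aemeasurable, lintegral_congr_ae hc']
    simp
  have hνAB : ν (A ×ˢ B) = ∫⁻ y in B, κ y A ∂T.μ := by
    rw [← Measure.compProd_apply_prod hB hA, hκ,
      Measure.map_apply measurable_swap (hB.prod hA), Set.preimage_swap_prod]
  rw [hνAB, lintegral_congr_ae (ae_restrict_of_ae hc'), Measure.prod_prod, hSA]
  simp
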